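/- Let $n\ge 0$, let $\Omega\subset\mathbb{R}^n$ be a smoothly bounded open set, i.e. $\Omega=\{x\in\mathbb{R}^n : r(x)<0\}$ for some $C^\infty$ function $r:\mathbb{R}^n\to\mathbb{R}$ such that $\{r=0\}$ is the topological boundary $b\Omega$ of $\Omega$ and $\nabla r\neq 0$ in a neighborhood of $b\Omega$. Let $p\in b\Omega$, let $U\subset\mathbb{R}^n$ be an open neighborhood of $p$, and let $\sigma:U\to\mathbb{R}$ be a smooth local defining function for $\Omega$ on $U$ (that is, $\sigma\in C^\infty(U)$ and $\Omega\cap U=\{x\in U:\sigma(x)<0\}$) with $\|\nabla\sigma\|=1$ on $b\Omega\cap U$. For a $C^\infty$ function $f$ near $x$ and $\xi,\zeta\in\mathbb{R}^n$ write $H_f(\xi,\zeta)(x)=\sum_{j,k=1}^n\frac{\partial^2 f}{\partial x_j\partial x_k}(x)\,\xi_j\zeta_k$. Suppose that $\Omega$ is convex on $U$: for some smooth local defining function $\rho$ for $\Omega$ on $U$ with $\nabla\rho\ne0$ on $b\Omega\cap U$, one has $H_\rho(\xi,\xi)(x)\ge 0$ for all $x\in b\Omega\cap U$ and all $\xi\in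 T_x(b\Omega)=\{\xi\in\mathbb{R}^n:\langle\nabla\rho(x),\xi\rangle=0\}$ (this condition does not depend on the choice of $\rho$). Then there exist an open neighborhood $V\subset U$ of $p$ and constants $C_1,C_2>0$ such that, for all $x\in V$, $\nabla\sigma(x)\neq0$ and $$H_\sigma(\xi,\xi)(x)\;\ge\;-C_1\,\sigma(x)^2\,\|\xi\|^2-C_2\,\frac{|\langle\nabla\sigma(x),\xi\rangle|^2}{\|\nabla\sigma(x)\|^2}\qquad\text{for all }\xi\in\mathbb{R}^n.$$ -/

import Mathlib

open scoped ContDiff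

noncomputable section

/-- The real Hessian `H_f(ξ, ζ)(x) = ∑ⱼₖ ∂²f/∂xⱼ∂xₖ (x) ξⱼ ζₖ` of `f` at `x`, as the second
Fréchet derivative of `f` applied to `ξ` and `ζ`. -/
def realHessian {n : ℕ} (f : EuclideanSpace ℝ (Fin n) → ℝ) (ξ ζ x : EuclideanSpace ℝ (Fin n)) :
    ℝ :=
  fderiv ℝ (fderiv ℝ f) x ξ ζ

/-- An open set `Ω` with smooth boundary: `Ω = {r < 0}` for some smooth `r` on the whole space, with
`{r = 0} = bΩ` and `∇r ≠ 0` in a neighbourhood of `bΩ`, where `bΩ = frontier Ω`. -/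
def IsSmoothlyBounded {n : ℕ} (Ω : Set (EuclideanSpace ℝ (Fin n))) : Prop :=
  ∃ r : EuclideanSpace ℝ (Fin n) → ℝ,
    ContDiff ℝ ∞ r ∧ Ω = {x | r x < 0} ∧ {x | r x = 0} = frontier Ω ∧
      ∃ N : Set (EuclideanSpace ℝ (Fin n)),
        IsOpen N ∧ frontier Ω ⊆ N ∧ ∀ x ∈ N, gradient r x ≠ 0

/-- `r` is a smooth local defining function for `Ω` on the open set `U`. Only the values of `r`
on `U` matter. -/
def IsSmoothLocalDefiningFunction {n : ℕ} (Ω U : Set (EuclideanSpace ℝ (Fin n)))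
    (r : EuclideanSpace ℝ (Fin n) → ℝ) : Prop :=
  ContDiffOn ℝ ∞ r U ∧ Ω ∩ U = {x ∈ U | r x < 0}

/-- `Ω` is convex on the open set `U`: for some smooth local defining function `r` for `Ω` on `U`
with nonvanishing gradient on `bΩ ∩ U`, the Hessian of `r` at the points `x` of `bΩ ∩ U` is
nonnegative on `T_x(bΩ) = {ξ | ⟨∇r(x), ξ⟩ = 0}`. Neither the condition nor the tangent space
depends on the choice of `r`. -/
def IsConvexDomainOn {n : ℕ} (Ω U : Set (EuclideanSpace ℝ (Fin n))) : Prop :=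
  ∃ r : EuclideanSpace ℝ (Fin n) → ℝ,
    IsSmoothLocalDefiningFunction Ω U r ∧
      (∀ x ∈ frontier Ω ∩ U, gradient r x ≠ 0) ∧
      ∀ x ∈ frontier Ω ∩ U, ∀ ξ : EuclideanSpace ℝ (Fin n),
        inner ℝ (gradient r x) ξ = 0 → 0 ≤ realHessian r ξ ξ x

end

open Filter Topology Asymptotics
open scoped Gradient

/-!
Along the zero set of `σ` the gradient `ν = ∇σ` has length one. Differentiating `‖∇σ‖² = 1` once
along this hypersurface gives `D²σ(τ, ν) = 0` for tangential `τ`, and differentiating it twice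
expresses `D³σ(ν, τ, τ)` by `‖D²σ(τ, ·)‖²` and `D²σ(τ, τ)`. Where `D²σ` is nonnegative on the
tangent space, the Cauchy-Schwarz inequality therefore gives `|D³σ(ν, τ, τ)| ≤ C D²σ(τ, τ)`. Every
point `x` near the zero set is of the form `y + t ν(y)` with `σ y = 0`, and moving along `ν` costs
at most the fraction `C |t|` of `D²σ(τ, τ) ≥ 0`, up to the quadratic Taylor remainder. So the
tangential Hessian at `x` is at least `-C t² ‖τ‖²`, where `|t|` is comparable to `|σ x|`.
-/

section NormedSpace

variable {E F : Type*} [NormedAddCommGroup E] [NormedSpace ℝ E] [NormedAddCommGroup F]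
  [NormedSpace ℝ F]

lemma fderiv_mul_fderiv_comm_of_const_on_level [CompleteSpace E] {f g : E → ℝ}
    {f' g' : E →L[ℝ] ℝ} {y : E} (hf : HasStrictFDerivAt f f' y) (hg : HasStrictFDerivAt g g' y)
    (h : ∀ᶠ x in 𝓝 y, g x = g y → f x = f y) (v w : E) : f' v * g' w = f' w * g' v := by
  have hmin : IsLocalExtrOn f {x | g x = g y} y :=
    Or.inl (eventually_nhdsWithin_iff.2 (h.mono fun _ hx hxg => (hx hxg).ge))
  obtain ⟨a, b, hab, hlin⟩ := hmin.exists_multipliers_of_hasStrictFDerivAt_1d hg hf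
  have hv : a * g' v + b * f' v = 0 := congrArg (fun φ : E →L[ℝ] ℝ => φ v) hlin
  have hw : a * g' w + b * f' w = 0 := congrArg (fun φ : E →L[ℝ] ℝ => φ w) hlin
  have ha : a * (f' v * g' w - f' w * g' v) = 0 := by linear_combination f' v * hw - f' w * hv
  have hb : b * (f' v * g' w - f' w * g' v) = 0 := by linear_combination g' w * hv - g' v * hw
  by_contra hne
  have hsub := sub_ne_zero.2 hne
  exact hab (Prod.ext ((mul_eq_zero.1 ha).resolve_right hsub)
    ((mul_eq_zero.1 hb).resolve_right hsub))

lemma fderiv_fderiv_mul_eq_of_const_on_level [CompleteSpace E] {f g : E → ℝ} {y τ v : E}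
    (hf : ContDiffAt ℝ 2 f y) (hg : ContDiffAt ℝ 2 g y)
    (h : ∀ᶠ x in 𝓝 y, g x = g y → f x = f y) (hτ : fderiv ℝ g y τ = 0)
    (hv : fderiv ℝ g y v ≠ 0) :
    fderiv ℝ (fderiv ℝ f) y τ τ * fderiv ℝ g y v =
      fderiv ℝ f y v * fderiv ℝ (fderiv ℝ g) y τ τ := by
  have strict {k : E → ℝ} {x : E} (hk : ContDiffAt ℝ 2 k x) :
      HasStrictFDerivAt k (fderiv ℝ k x) x := hk.hasStrictFDerivAt two_ne_zero
  have strict_apply {k : E → ℝ} (hk : ContDiffAt ℝ 2 k y) (w : E) :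
      HasStrictFDerivAt (fun x => fderiv ℝ k x w) ((fderiv ℝ (fderiv ℝ k) y).flip w) y :=
    ((hk.fderiv_right (m := 1) (by norm_num)).hasStrictFDerivAt one_ne_zero).clm_apply
      (hasStrictFDerivAt_const w y) |>.congr_fderiv (by ext; simp)
  -- The minor `Df τ · Dg v - Df v · Dg τ` vanishes along the whole level set, so it can be
  -- differentiated in the tangent direction `τ`.
  let m : E → ℝ := fun x => fderiv ℝ f x τ * fderiv ℝ g x v - fderiv ℝ f x v * fderiv ℝ g x τ
  have hm : HasStrictFDerivAt m _ y :=
    ((strict_apply hf τ).mul (strict_apply hg v)).sub ((strict_apply hf v).mul (strict_apply hg τ))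
  have hm0 : ∀ᶠ x in 𝓝 y, g x = g y → m x = 0 := by
    filter_upwards [hf.eventually (by simp), hg.eventually (by simp), h.eventually_nhds]
      with x hfx hgx hx hxy
    refine sub_eq_zero.2 (fderiv_mul_fderiv_comm_of_const_on_level (strict hfx) (strict hgx) ?_ τ v)
    filter_upwards [hx] with z hz hzx
    rw [hz (hzx.trans hxy), hx.self_of_nhds hxy]
  have hmτ := fderiv_mul_fderiv_comm_of_const_on_level hm (strict hg)
    (hm0.mono fun x hx hxy => by rw [hx hxy, hm0.self_of_nhds rfl]) τ v
  have hfτ := fderiv_mul_fderiv_comm_of_const_on_level (strict hf) (strict hg) h τ v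
  rw [hτ, mul_zero] at hmτ hfτ
  have hdm := (mul_eq_zero.1 hmτ).resolve_right hv
  have hdf := (mul_eq_zero.1 hfτ).resolve_right hv
  simp only [sub_apply, add_apply, smul_apply, ContinuousLinearMap.flip_apply, smul_eq_mul, hdf]
    at hdm
  linarith

lemma nhds_le_map_add_smul_nhdsWithin [CompleteSpace E] {g : E → ℝ} {g' : E →L[ℝ] ℝ} {V : E → E}
    {V' : E →L[ℝ] E} {p : E} (hg : HasStrictFDerivAt g g' p) (hV : HasStrictFDerivAt V V' p)
    (hgp : g p = 0) (hgV : g' (V p) ≠ 0) :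
    𝓝 p ≤ map (fun q : E × ℝ => q.1 + q.2 • V q.1) (𝓝[{q | g q.1 = 0}] (p, 0)) := by
  let Φ : E × ℝ → E × ℝ := fun q => (q.1 + q.2 • V q.1, g q.1)
  let Φ' : E × ℝ →L[ℝ] E × ℝ :=
    (ContinuousLinearMap.fst ℝ E ℝ + (ContinuousLinearMap.snd ℝ E ℝ).smulRight (V p)).prod
      (g' ∘L ContinuousLinearMap.fst ℝ E ℝ)
  have hΦ : HasStrictFDerivAt Φ Φ' (p, 0) := by
    have hfst := hasStrictFDerivAt_fst (𝕜 := ℝ) (p := (p, (0 : ℝ)))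
    have hsnd := hasStrictFDerivAt_snd (𝕜 := ℝ) (p := (p, (0 : ℝ)))
    refine ((hfst.add (hsnd.smul (HasStrictFDerivAt.comp (p, (0 : ℝ)) hV hfst))).prodMk
      (HasStrictFDerivAt.comp (p, (0 : ℝ)) hg hfst)).congr_fderiv ?_
    ext <;> simp [Φ']
  have hsurj : Φ'.range = ⊤ := by
    refine LinearMap.range_eq_top.2 fun ⟨w, r⟩ => ?_
    refine ⟨(w - ((g' w - r) / g' (V p)) • V p, (g' w - r) / g' (V p)), ?_⟩
    simp [Φ', hgV]
  have hmap : map Φ (𝓝 (p, 0)) = 𝓝 (p, 0) := by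
    simpa [Φ, hgp] using hΦ.map_nhds_eq_of_surj hsurj
  intro s hs
  have himage : Φ '' {q | g q.1 = 0 → q.1 + q.2 • V q.1 ∈ s} ∈ 𝓝 (p, 0) :=
    hmap ▸ image_mem_map (mem_nhdsWithin_iff_eventually.1 hs)
  have hslice : Tendsto (fun x : E => (x, (0 : ℝ))) (𝓝 p) (𝓝 (p, 0)) :=
    (Continuous.prodMk_left (0 : ℝ)).tendsto p
  filter_upwards [hslice himage] with x ⟨q, hq, hqx⟩
  obtain ⟨rfl, hq0⟩ := Prod.ext_iff.1 hqx
  exact hq hq0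

lemma isBigO_sub_sub_fderiv {f : E → F} {p : E} (hf : ContDiffAt ℝ 2 f p) :
    (fun q : E × E => f q.1 - f q.2 - fderiv ℝ f q.2 (q.1 - q.2))
      =O[𝓝 (p, p)] fun q => ‖q.1 - q.2‖ ^ 2 := by
  obtain ⟨K, s, hs, hK⟩ :=
    (hf.fderiv_right (m := 1) (by norm_num)).exists_lipschitzOnWith
  obtain ⟨ε, hε, hball⟩ := Metric.eventually_nhds_iff_ball.1
    ((eventually_mem_set.2 hs).and (hf.eventually (by simp)))
  refine IsBigO.of_bound K ?_
  filter_upwards [prod_mem_nhds (Metric.ball_mem_nhds p hε) (Metric.ball_mem_nhds p hε)]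
    with ⟨x, y⟩ ⟨hx, hy⟩
  have hseg : segment ℝ y x ⊆ Metric.ball p ε := (convex_ball p ε).segment_subset hy hx
  have hbound : ∀ z ∈ segment ℝ y x, ‖fderiv ℝ f z - fderiv ℝ f y‖ ≤ K * ‖x - y‖ := fun z hz =>
    (hK.norm_sub_le (hball z (hseg hz)).1 (hball y hy).1).trans
      (by gcongr; exact norm_sub_le_of_mem_segment hz)
  calc ‖f x - f y - fderiv ℝ f y (x - y)‖ ≤ K * ‖x - y‖ * ‖x - y‖ :=
        (convex_segment y x).norm_image_sub_le_of_norm_fderiv_le'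
          (fun z hz => (hball z (hseg hz)).2.differentiableAt two_ne_zero) hbound
          (left_mem_segment ℝ y x) (right_mem_segment ℝ y x)
    _ = K * ‖‖x - y‖ ^ 2‖ := by rw [norm_pow, norm_norm]; ring

section VectorField

variable {V : E → E} {p : E}

lemma tendsto_add_smul_prodMk_nhds (hV : ContinuousAt V p) :
    Tendsto (fun q : E × ℝ => (q.1 + q.2 • V q.1, q.1)) (𝓝 (p, 0)) (𝓝 (p, p)) := by
  have hVfst : ContinuousAt (fun q : E × ℝ => V q.1) (p, 0) := hV.comp_of_eq continuousAt_fst rfl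
  have : ContinuousAt (fun q : E × ℝ => (q.1 + q.2 • V q.1, q.1)) (p, 0) :=
    (continuousAt_fst.add (continuousAt_snd.smul hVfst)).prodMk continuousAt_fst
  simpa only [ContinuousAt, zero_smul, add_zero] using this

lemma isBigO_add_smul_sub_self (hV : ContinuousAt V p) :
    (fun q : E × ℝ => q.1 + q.2 • V q.1 - q.1) =O[𝓝 (p, 0)] fun q => q.2 := by
  have hV1 : (fun q : E × ℝ => V q.1) =O[𝓝 (p, 0)] fun _ => (1 : ℝ) :=
    (hV.comp_of_eq (f := Prod.fst) continuousAt_fst rfl).tendsto.isBigO_one ℝ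
  simpa using (isBigO_refl (fun q : E × ℝ => q.2) (𝓝 (p, 0))).smul hV1

lemma isBigO_comp_add_smul_sub {f : E → F} (hf : ContDiffAt ℝ 1 f p) (hV : ContinuousAt V p) :
    (fun q : E × ℝ => f (q.1 + q.2 • V q.1) - f q.1) =O[𝓝 (p, 0)] fun q => q.2 :=
  ((hf.hasStrictFDerivAt one_ne_zero).isBigO_sub.comp_tendsto
    (tendsto_add_smul_prodMk_nhds hV)).trans (isBigO_add_smul_sub_self hV)

lemma isBigO_comp_add_smul_sub_sub_fderiv {f : E → F} (hf : ContDiffAt ℝ 2 f p)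
    (hV : ContinuousAt V p) :
    (fun q : E × ℝ => f (q.1 + q.2 • V q.1) - f q.1 - q.2 • fderiv ℝ f q.1 (V q.1))
      =O[𝓝 (p, 0)] fun q => q.2 ^ 2 := by
  have h := ((isBigO_sub_sub_fderiv hf).comp_tendsto (tendsto_add_smul_prodMk_nhds hV)).trans
    ((isBigO_add_smul_sub_self hV).norm_left.pow 2)
  simpa [Function.comp_def] using h

lemma isBigO_snd_comp_add_smul_sub {g : E → ℝ} {g' : E →L[ℝ] ℝ} (hg : HasStrictFDerivAt g g' p)
    (hV : ContinuousAt V p) (hgV : g' (V p) ≠ 0) :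
    (fun q : E × ℝ => q.2) =O[𝓝 (p, 0)] fun q => g (q.1 + q.2 • V q.1) - g q.1 := by
  have hlin : (fun q : E × ℝ => g (q.1 + q.2 • V q.1) - g q.1 - g' (q.1 + q.2 • V q.1 - q.1))
      =o[𝓝 (p, 0)] fun q => q.2 :=
    (hg.isLittleO.comp_tendsto (tendsto_add_smul_prodMk_nhds hV)).trans_isBigO
      (isBigO_add_smul_sub_self hV)
  have hVp : (fun q : E × ℝ => q.2 * (g' (V q.1) - g' (V p))) =o[𝓝 (p, 0)] fun q => q.2 := by
    have hcont : ContinuousAt (fun q : E × ℝ => g' (V q.1)) (p, 0) :=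
      g'.continuous.continuousAt.comp (hV.comp_of_eq (f := Prod.fst) continuousAt_fst rfl)
    simpa using (isBigO_refl (fun q : E × ℝ => q.2) (𝓝 (p, 0))).mul_isLittleO
      ((isLittleO_one_iff ℝ).2 (tendsto_sub_nhds_zero_iff.2 hcont.tendsto))
  have hsnd : (fun q : E × ℝ => q.2) =O[𝓝 (p, 0)] fun q => g' (V p) * q.2 :=
    isBigO_self_const_mul hgV _ _
  have hequiv : (fun q : E × ℝ => g (q.1 + q.2 • V q.1) - g q.1)
      ~[𝓝 (p, 0)] fun q => g' (V p) * q.2 := by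
    refine ((hlin.add hVp).trans_isBigO hsnd).congr_left fun q => ?_
    simp only [add_sub_cancel_left, map_smul, smul_eq_mul, Pi.sub_apply]
    ring
  exact hsnd.trans hequiv.isBigO_symm

end VectorField

lemma fderiv_fderiv_fderiv_rotate {f : E → ℝ} {x : E} (hf : ContDiffAt ℝ 3 f x) (ξ ζ : E) :
    fderiv ℝ (fderiv ℝ (fderiv ℝ f)) x ξ ξ ζ = fderiv ℝ (fderiv ℝ (fderiv ℝ f)) x ζ ξ ξ := by
  have hf' : ContDiffAt ℝ 2 (fderiv ℝ f) x := hf.fderiv_right (by norm_num)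
  have hf'' : DifferentiableAt ℝ (fderiv ℝ (fderiv ℝ f)) x :=
    (hf'.fderiv_right (m := 1) (by norm_num)).differentiableAt one_ne_zero
  have hderiv (a b : E) : HasFDerivAt (fun z => fderiv ℝ (fderiv ℝ f) z a b)
      (((fderiv ℝ (fderiv ℝ (fderiv ℝ f)) x).flip a).flip b) x :=
    ((hf''.hasFDerivAt.clm_apply (hasFDerivAt_const a x)).clm_apply
      (hasFDerivAt_const b x)).congr_fderiv (by ext; simp)
  have hsymm : ∀ᶠ z in 𝓝 x, fderiv ℝ (fderiv ℝ f) z ξ ζ = fderiv ℝ (fderiv ℝ f) z ζ ξ := by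
    filter_upwards [hf.eventually (by simp)] with z hz
    exact (hz.isSymmSndFDerivAt (by simp; norm_num)).eq ξ ζ
  calc fderiv ℝ (fderiv ℝ (fderiv ℝ f)) x ξ ξ ζ = fderiv ℝ (fderiv ℝ (fderiv ℝ f)) x ξ ζ ξ :=
        congrArg (fun φ : E →L[ℝ] ℝ => φ ξ)
          ((hderiv ξ ζ).unique ((hderiv ζ ξ).congr_of_eventuallyEq hsymm))
    _ = fderiv ℝ (fderiv ℝ (fderiv ℝ f)) x ζ ξ ξ := by
        rw [(hf'.isSymmSndFDerivAt (by simp)).eq ξ ζ]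

end NormedSpace

section InnerProductSpace

variable {E : Type*} [NormedAddCommGroup E] [InnerProductSpace ℝ E]

lemma neg_le_apply_self_of_tangential_bounds {B : E →L[ℝ] E →L[ℝ] ℝ} (hB : ∀ v w, B v w = B w v)
    {ν : E} (hν : ‖ν‖ = 1) {α β γ : ℝ} (hα : 0 ≤ α)
    (htan : ∀ τ, inner ℝ ν τ = 0 → -(α * ‖τ‖ ^ 2) ≤ B τ τ)
    (hmix : ∀ τ, inner ℝ ν τ = 0 → |B τ ν| ≤ β * ‖τ‖) (hnor : -γ ≤ B ν ν) (ξ : E) :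
    -((α + β ^ 2) * ‖ξ‖ ^ 2) - (1 + γ) * inner ℝ ν ξ ^ 2 ≤ B ξ ξ := by
  obtain ⟨a, ha⟩ : ∃ a : ℝ, a = inner ℝ ν ξ := ⟨_, rfl⟩
  obtain ⟨τ, hτ⟩ : ∃ τ, ξ = τ + a • ν := ⟨ξ - a • ν, (sub_add_cancel _ _).symm⟩
  have hντ : inner ℝ ν τ = 0 := by
    rw [hτ, inner_add_right, real_inner_smul_right, real_inner_self_eq_norm_sq, hν] at ha
    linarith
  have hnorm : ‖ξ‖ ^ 2 = ‖τ‖ ^ 2 + a ^ 2 := by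
    rw [hτ, norm_add_sq_real, real_inner_smul_right, real_inner_comm, hντ, norm_smul, hν,
      mul_one, Real.norm_eq_abs, sq_abs]
    ring
  have hcross : -(a ^ 2 + β ^ 2 * ‖τ‖ ^ 2) ≤ 2 * (a * B τ ν) := by
    have hsq : B τ ν ^ 2 ≤ β ^ 2 * ‖τ‖ ^ 2 := by
      rw [← mul_pow, ← sq_abs]
      exact pow_le_pow_left₀ (abs_nonneg _) (hmix τ hντ) 2
    linarith [sq_nonneg (a + B τ ν)]
  calc -((α + β ^ 2) * ‖ξ‖ ^ 2) - (1 + γ) * inner ℝ ν ξ ^ 2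
      ≤ -(α * ‖τ‖ ^ 2) - (a ^ 2 + β ^ 2 * ‖τ‖ ^ 2) + a ^ 2 * -γ := by
        rw [hnorm, ← ha]
        linarith [mul_nonneg (add_nonneg hα (sq_nonneg β)) (sq_nonneg a)]
    _ ≤ B τ τ + 2 * (a * B τ ν) + a ^ 2 * B ν ν := by
        linarith [htan τ hντ, mul_le_mul_of_nonneg_left hnor (sq_nonneg a)]
    _ = B ξ ξ := by
        rw [hτ]
        simp only [map_add, map_smul, add_apply, smul_apply, smul_eq_mul, hB ν τ]
        ring

/-- Here `D` plays the role of the derivative of the form along `ν`. The hypothesis `hD` controls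
its first-order loss by a fraction of the form `A` itself, so that only `t ^ 2` is lost. -/
lemma neg_sq_le_apply_self_of_taylor {A B D : E →L[ℝ] E →L[ℝ] ℝ} {τ : E} {K t : ℝ}
    (hAK : ‖A‖ ≤ K) (hKt : 2 * K * |t| ≤ 1) (hBD : ‖B - A - t • D‖ ≤ K * t ^ 2)
    (hA : 0 ≤ A τ τ) (hD : |D τ τ| ≤ 2 * ‖A‖ * A τ τ) : -(K * t ^ 2 * ‖τ‖ ^ 2) ≤ B τ τ := by
  have htD : |t * D τ τ| ≤ A τ τ :=
    calc |t * D τ τ| ≤ |t| * (2 * ‖A‖ * A τ τ) := by rw [abs_mul]; gcongr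
      _ ≤ |t| * (2 * K * A τ τ) := by gcongr
      _ = 2 * K * |t| * A τ τ := by ring
      _ ≤ A τ τ := mul_le_of_le_one_left hA hKt
  have hrem : |B τ τ - A τ τ - t * D τ τ| ≤ K * t ^ 2 * ‖τ‖ ^ 2 :=
    calc |B τ τ - A τ τ - t * D τ τ| ≤ ‖B - A - t • D‖ * ‖τ‖ * ‖τ‖ :=
          (B - A - t • D).le_opNorm₂ τ τ
      _ ≤ K * t ^ 2 * ‖τ‖ * ‖τ‖ := by gcongr
      _ = K * t ^ 2 * ‖τ‖ ^ 2 := by ring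
  linarith [neg_le_of_abs_le htD, neg_le_of_abs_le hrem]

lemma inner_sq_le_two_mul_add {u v : E} {c : ℝ} (huv : ‖v - u‖ ≤ c) (ξ : E) :
    inner ℝ u ξ ^ 2 ≤ 2 * inner ℝ v ξ ^ 2 + 2 * c ^ 2 * ‖ξ‖ ^ 2 := by
  have hdiff : (inner ℝ v ξ - inner ℝ u ξ) ^ 2 ≤ c ^ 2 * ‖ξ‖ ^ 2 := by
    rw [← inner_sub_left, ← mul_pow, ← sq_abs]
    gcongr
    exact (abs_real_inner_le_norm _ _).trans (by gcongr)
  linarith [sq_nonneg (2 * inner ℝ v ξ - inner ℝ u ξ)]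

variable [CompleteSpace E]

lemma norm_apply_sq_le_of_nonneg_orthogonal {A : E →L[ℝ] E →L[ℝ] ℝ} (hA : ∀ v w, A v w = A w v)
    {ν τ : E} (hpos : ∀ w, inner ℝ ν w = 0 → 0 ≤ A w w) (hτ : inner ℝ ν τ = 0)
    (hAν : A τ ν = 0) : ‖A τ‖ ^ 2 ≤ ‖A‖ * A τ τ := by
  obtain ⟨η, hη⟩ := (InnerProductSpace.toDual ℝ E).surjective (A τ)
  have hη_norm : ‖A τ‖ = ‖η‖ := by rw [← hη, LinearIsometryEquiv.norm_map]
  have hη_inner (w : E) : A τ w = inner ℝ η w := by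
    rw [← hη, InnerProductSpace.toDual_apply_apply]
  rcases (norm_nonneg A).eq_or_lt with hA0 | hA0
  · have hAτ : ‖A τ‖ ≤ 0 := (A.le_opNorm τ).trans_eq (by rw [← hA0, zero_mul])
    rw [hAτ.antisymm (norm_nonneg _), ← hA0]
    simp
  rw [hη_norm]
  -- The form is nonnegative at `‖A‖ τ - η`, which is orthogonal to `ν` as well.
  have hw := hpos (‖A‖ • τ - η) (by
    rw [inner_sub_right, real_inner_smul_right, hτ, real_inner_comm, ← hη_inner, hAν]
    simp)
  have hτη : A τ η = ‖η‖ ^ 2 := by rw [hη_inner, real_inner_self_eq_norm_sq]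
  have hηη : A η η ≤ ‖A‖ * ‖η‖ ^ 2 := by
    simpa [sq, mul_assoc] using (le_abs_self _).trans (A.le_opNorm₂ η η)
  simp only [map_sub, map_smul, sub_apply, smul_apply, smul_eq_mul, hA η τ, hτη] at hw
  refine le_of_mul_le_mul_left ?_ hA0
  linarith

section Gradient

variable {f : E → ℝ} {x y : E}

lemma fderiv_apply_gradient (f : E → ℝ) (x : E) : fderiv ℝ f x (∇ f x) = ‖∇ f x‖ ^ 2 := by
  rw [← inner_gradient_left, real_inner_self_eq_norm_sq]

lemma gradient_ne_zero_iff : ∇ f x ≠ 0 ↔ fderiv ℝ f x ≠ 0 := by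
  rw [← toDual_gradient, Ne, Ne, LinearIsometryEquiv.map_eq_zero_iff]

lemma contDiffAt_gradient {m n : WithTop ℕ∞} (hf : ContDiffAt ℝ n f x) (hmn : m + 1 ≤ n) :
    ContDiffAt ℝ m (∇ f) x := by
  have hriesz : IsBoundedLinearMap ℝ (InnerProductSpace.toDual ℝ E).symm :=
    ⟨⟨map_add _, fun c φ => by simp⟩, 1, one_pos, fun φ => by simp⟩
  exact hriesz.contDiff.contDiffAt.comp x (hf.fderiv_right hmn)

lemma hasFDerivAt_gradient (hf : ContDiffAt ℝ 2 f x) :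
    HasFDerivAt (∇ f) (fderiv ℝ (∇ f) x) x :=
  ((contDiffAt_gradient (m := 1) hf (by norm_num)).differentiableAt one_ne_zero).hasFDerivAt

lemma inner_fderiv_gradient (hf : ContDiffAt ℝ 2 f x) (ξ ζ : E) :
    inner ℝ (fderiv ℝ (∇ f) x ξ) ζ = fderiv ℝ (fderiv ℝ f) x ξ ζ := by
  have hf' : HasFDerivAt (fderiv ℝ f) (fderiv ℝ (fderiv ℝ f) x) x :=
    ((hf.fderiv_right (m := 1) (by norm_num)).differentiableAt one_ne_zero).hasFDerivAt
  have hinner := (hasFDerivAt_gradient hf).inner ℝ (hasFDerivAt_const ζ x)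
  simp only [inner_gradient_left] at hinner
  have h := congrArg (fun φ : E →L[ℝ] ℝ => φ ξ)
    (hinner.unique (hf'.clm_apply (hasFDerivAt_const ζ x)))
  simpa [fderivInnerCLM_apply] using h

lemma norm_fderiv_gradient_apply (hf : ContDiffAt ℝ 2 f x) (ξ : E) :
    ‖fderiv ℝ (∇ f) x ξ‖ = ‖fderiv ℝ (fderiv ℝ f) x ξ‖ := by
  rw [← LinearIsometryEquiv.norm_map (InnerProductSpace.toDual ℝ E)]
  congr 1
  ext ζ
  rw [InnerProductSpace.toDual_apply_apply, inner_fderiv_gradient hf]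

lemma fderiv_norm_sq_gradient (hf : ContDiffAt ℝ 2 f x) (ξ : E) :
    fderiv ℝ (fun z => ‖∇ f z‖ ^ 2) x ξ = 2 * fderiv ℝ (fderiv ℝ f) x ξ (∇ f x) := by
  rw [(hasFDerivAt_gradient hf).norm_sq.fderiv, ← inner_fderiv_gradient hf, real_inner_comm]
  simp

lemma fderiv_fderiv_norm_sq_gradient (hf : ContDiffAt ℝ 3 f x) (ξ : E) :
    fderiv ℝ (fderiv ℝ (fun z => ‖∇ f z‖ ^ 2)) x ξ ξ =
      2 * (fderiv ℝ (fderiv ℝ (fderiv ℝ f)) x (∇ f x) ξ ξ + ‖fderiv ℝ (fderiv ℝ f) x ξ‖ ^ 2) := by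
  have hf2 : ContDiffAt ℝ 2 f x := hf.of_le (by norm_num)
  have hf'' : DifferentiableAt ℝ (fderiv ℝ (fderiv ℝ f)) x :=
    ((hf.fderiv_right (m := 2) (by norm_num)).fderiv_right (m := 1)
      (by norm_num)).differentiableAt one_ne_zero
  have hk' : DifferentiableAt ℝ (fderiv ℝ (fun z => ‖∇ f z‖ ^ 2)) x :=
    (((contDiffAt_gradient hf (m := 2) (by norm_num)).norm_sq ℝ).fderiv_right (m := 1)
      (by norm_num)).differentiableAt one_ne_zero
  have hfirst : (fun z => fderiv ℝ (fun z => ‖∇ f z‖ ^ 2) z ξ)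
      =ᶠ[𝓝 x] fun z => 2 * fderiv ℝ (fderiv ℝ f) z ξ (∇ f z) := by
    filter_upwards [hf2.eventually (by simp)] with z hz using fderiv_norm_sq_gradient hz ξ
  have hsecond := congrArg (fun φ : E →L[ℝ] ℝ => φ ξ)
    ((hk'.hasFDerivAt.clm_apply (hasFDerivAt_const ξ x)).unique
      ((((hf''.hasFDerivAt.clm_apply (hasFDerivAt_const ξ x)).clm_apply
        (hasFDerivAt_gradient hf2)).const_mul 2).congr_of_eventuallyEq hfirst))
  have hnorm : fderiv ℝ (fderiv ℝ f) x ξ (fderiv ℝ (∇ f) x ξ) =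
      ‖fderiv ℝ (fderiv ℝ f) x ξ‖ ^ 2 := by
    rw [← inner_fderiv_gradient hf2, real_inner_self_eq_norm_sq, norm_fderiv_gradient_apply hf2]
  rw [← fderiv_fderiv_fderiv_rotate hf, ← hnorm, add_comm]
  simpa [mul_add] using hsecond

lemma fderiv_fderiv_apply_gradient_eq_zero (hf : ContDiffAt ℝ 2 f y)
    (h : ∀ᶠ x in 𝓝 y, f x = f y → ‖∇ f x‖ = ‖∇ f y‖) {τ : E} (hτ : inner ℝ (∇ f y) τ = 0) :
    fderiv ℝ (fderiv ℝ f) y τ (∇ f y) = 0 := by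
  rcases eq_or_ne (∇ f y) 0 with hfy | hfy
  · rw [hfy, map_zero]
  have hlevel := fderiv_mul_fderiv_comm_of_const_on_level
    (((contDiffAt_gradient hf (m := 1) (by norm_num)).norm_sq ℝ).hasStrictFDerivAt one_ne_zero)
    (hf.hasStrictFDerivAt two_ne_zero) (h.mono fun x hx hxy => by rw [hx hxy]) τ (∇ f y)
  rw [inner_gradient_left] at hτ
  simpa [fderiv_norm_sq_gradient hf, fderiv_apply_gradient, hτ, hfy] using hlevel

/-- A Riccati equation for the second fundamental form of the level set. -/
lemma fderiv_fderiv_fderiv_gradient_add_mul (hf : ContDiffAt ℝ 3 f y)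
    (h : ∀ᶠ x in 𝓝 y, f x = f y → ‖∇ f x‖ = ‖∇ f y‖) (hfy : ∇ f y ≠ 0) {τ : E}
    (hτ : inner ℝ (∇ f y) τ = 0) :
    (fderiv ℝ (fderiv ℝ (fderiv ℝ f)) y (∇ f y) τ τ + ‖fderiv ℝ (fderiv ℝ f) y τ‖ ^ 2)
        * ‖∇ f y‖ ^ 2 =
      fderiv ℝ (fderiv ℝ f) y (∇ f y) (∇ f y) * fderiv ℝ (fderiv ℝ f) y τ τ := by
  have hf2 : ContDiffAt ℝ 2 f y := hf.of_le (by norm_num)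
  have hlevel := fderiv_fderiv_mul_eq_of_const_on_level
    ((contDiffAt_gradient hf (m := 2) (by norm_num)).norm_sq ℝ) hf2
    (h.mono fun x hx hxy => by rw [hx hxy]) (by rwa [← inner_gradient_left])
    (v := ∇ f y) (by rw [fderiv_apply_gradient]; positivity)
  rw [fderiv_fderiv_norm_sq_gradient hf, fderiv_norm_sq_gradient hf2, fderiv_apply_gradient]
    at hlevel
  linarith

lemma abs_fderiv_fderiv_fderiv_gradient_le (hf : ContDiffAt ℝ 3 f y)
    (h : ∀ᶠ x in 𝓝 y, f x = f y → ‖∇ f x‖ = ‖∇ f y‖)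
    (hpos : ∀ w, inner ℝ (∇ f y) w = 0 → 0 ≤ fderiv ℝ (fderiv ℝ f) y w w) {τ : E}
    (hτ : inner ℝ (∇ f y) τ = 0) :
    |fderiv ℝ (fderiv ℝ (fderiv ℝ f)) y (∇ f y) τ τ| ≤
      2 * ‖fderiv ℝ (fderiv ℝ f) y‖ * fderiv ℝ (fderiv ℝ f) y τ τ := by
  have hf2 : ContDiffAt ℝ 2 f y := hf.of_le (by norm_num)
  have hAττ := hpos τ hτ
  rcases eq_or_ne (∇ f y) 0 with hν0 | hν0
  · rw [hν0, map_zero, zero_apply, zero_apply, abs_zero]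
    positivity
  have hriccati := fderiv_fderiv_fderiv_gradient_add_mul hf h hν0 hτ
  set A := fderiv ℝ (fderiv ℝ f) y
  set ν := ∇ f y
  have hcauchy : ‖A τ‖ ^ 2 ≤ ‖A‖ * A τ τ :=
    norm_apply_sq_le_of_nonneg_orthogonal (hf2.isSymmSndFDerivAt (by simp)).eq hpos hτ
      (fderiv_fderiv_apply_gradient_eq_zero hf2 h hτ)
  have hcurv : |A ν ν * A τ τ| ≤ ‖A‖ * A τ τ * ‖ν‖ ^ 2 :=
    calc |A ν ν * A τ τ| ≤ ‖A‖ * ‖ν‖ * ‖ν‖ * A τ τ := by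
          rw [abs_mul, abs_of_nonneg hAττ]
          gcongr
          exact A.le_opNorm₂ ν ν
      _ = ‖A‖ * A τ τ * ‖ν‖ ^ 2 := by ring
  refine le_of_mul_le_mul_right ?_ (by positivity : 0 < ‖ν‖ ^ 2)
  calc |fderiv ℝ (fderiv ℝ (fderiv ℝ f)) y ν τ τ| * ‖ν‖ ^ 2
      = |A ν ν * A τ τ - ‖A τ‖ ^ 2 * ‖ν‖ ^ 2| := by
        rw [← hriccati, add_mul, add_sub_cancel_right, abs_mul, abs_of_nonneg (sq_nonneg ‖ν‖)]
    _ ≤ |A ν ν * A τ τ| + ‖A τ‖ ^ 2 * ‖ν‖ ^ 2 := by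
        refine (abs_sub _ _).trans_eq ?_
        rw [abs_of_nonneg (by positivity : 0 ≤ ‖A τ‖ ^ 2 * ‖ν‖ ^ 2)]
    _ ≤ ‖A‖ * A τ τ * ‖ν‖ ^ 2 + ‖A‖ * A τ τ * ‖ν‖ ^ 2 := by gcongr
    _ = 2 * ‖A‖ * A τ τ * ‖ν‖ ^ 2 := by ring

end Gradient

section NormalDisplacement

variable {f : E → ℝ} {p x y : E} {K t : ℝ}

lemma neg_sq_le_fderiv_fderiv_of_orthogonal (hf : ContDiffAt ℝ 3 f y)
    (h : ∀ᶠ z in 𝓝 y, f z = f y → ‖∇ f z‖ = ‖∇ f y‖)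
    (hpos : ∀ w, inner ℝ (∇ f y) w = 0 → 0 ≤ fderiv ℝ (fderiv ℝ f) y w w)
    (hK : ‖fderiv ℝ (fderiv ℝ f) y‖ ≤ K) (hKt : 2 * K * |t| ≤ 1)
    (htaylor : ‖fderiv ℝ (fderiv ℝ f) x - fderiv ℝ (fderiv ℝ f) y
      - t • fderiv ℝ (fderiv ℝ (fderiv ℝ f)) y (∇ f y)‖ ≤ K * t ^ 2) {τ : E}
    (hτ : inner ℝ (∇ f y) τ = 0) :
    -(K * t ^ 2 * ‖τ‖ ^ 2) ≤ fderiv ℝ (fderiv ℝ f) x τ τ :=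
  neg_sq_le_apply_self_of_taylor hK hKt htaylor (hpos τ hτ)
    (abs_fderiv_fderiv_fderiv_gradient_le hf h hpos hτ)

lemma neg_le_fderiv_fderiv_apply_self (hfx : ContDiffAt ℝ 2 f x) (hf : ContDiffAt ℝ 3 f y)
    (h : ∀ᶠ z in 𝓝 y, f z = f y → ‖∇ f z‖ = 1)
    (hpos : ∀ w, inner ℝ (∇ f y) w = 0 → 0 ≤ fderiv ℝ (fderiv ℝ f) y w w)
    (hK : ‖fderiv ℝ (fderiv ℝ f) y‖ ≤ K) (hKt : 2 * K * |t| ≤ 1)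
    (hgrad : ‖∇ f x - ∇ f y‖ ≤ K * |t|)
    (hhess : ‖fderiv ℝ (fderiv ℝ f) x - fderiv ℝ (fderiv ℝ f) y‖ ≤ K * |t|)
    (htaylor : ‖fderiv ℝ (fderiv ℝ f) x - fderiv ℝ (fderiv ℝ f) y
      - t • fderiv ℝ (fderiv ℝ (fderiv ℝ f)) y (∇ f y)‖ ≤ K * t ^ 2) (ξ : E) :
    -(K * (1 + 5 * K + 2 * K ^ 2) * t ^ 2 * ‖ξ‖ ^ 2) - 2 * (2 + K) * inner ℝ (∇ f x) ξ ^ 2 ≤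
      fderiv ℝ (fderiv ℝ f) x ξ ξ := by
  have hν : ‖∇ f y‖ = 1 := h.self_of_nhds rfl
  have hlevel : ∀ᶠ z in 𝓝 y, f z = f y → ‖∇ f z‖ = ‖∇ f y‖ := by rwa [hν]
  have hK0 : 0 ≤ K := (ContinuousLinearMap.opNorm_nonneg _).trans hK
  set A := fderiv ℝ (fderiv ℝ f) y
  set B := fderiv ℝ (fderiv ℝ f) x
  set ν := ∇ f y
  have hmix (τ : E) (hτ : inner ℝ ν τ = 0) : |B τ ν| ≤ K * |t| * ‖τ‖ := by
    have hAτν : A τ ν = 0 :=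
      fderiv_fderiv_apply_gradient_eq_zero (hf.of_le (by norm_num)) hlevel hτ
    calc |B τ ν| = ‖(B - A) τ ν‖ := by simp [hAτν]
      _ ≤ ‖B - A‖ * ‖τ‖ * ‖ν‖ := (B - A).le_opNorm₂ τ ν
      _ ≤ K * |t| * ‖τ‖ := by rw [hν, mul_one]; gcongr
  have hnor : -(1 + K) ≤ B ν ν := by
    refine neg_le_of_abs_le ?_
    calc |B ν ν| ≤ ‖B‖ * ‖ν‖ * ‖ν‖ := B.le_opNorm₂ ν ν
      _ ≤ ‖B - A‖ + ‖A‖ := by rw [hν, mul_one, mul_one]; exact norm_le_norm_sub_add B A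
      _ ≤ 1 + K := by linarith [mul_nonneg hK0 (abs_nonneg t)]
  have hB := neg_le_apply_self_of_tangential_bounds
    (hfx.isSymmSndFDerivAt (by simp)).eq hν (by positivity : 0 ≤ K * t ^ 2)
    (fun τ => neg_sq_le_fderiv_fderiv_of_orthogonal hf hlevel hpos hK hKt htaylor) hmix hnor ξ
  have hinner := mul_le_mul_of_nonneg_left (inner_sq_le_two_mul_add hgrad ξ)
    (by positivity : 0 ≤ 2 + K)
  rw [mul_pow, sq_abs] at hB hinner
  linarith

lemma exists_gradient_displacement_bounds (hf : ContDiffAt ℝ 4 f p) (hfp : ∇ f p ≠ 0) :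
    ∃ K : ℝ, 0 < K ∧ ∀ᶠ q : E × ℝ in 𝓝 (p, 0),
      let x := q.1 + q.2 • ∇ f q.1
      ‖fderiv ℝ (fderiv ℝ f) q.1‖ ≤ K ∧ 2 * K * |q.2| ≤ 1 ∧ ‖∇ f x - ∇ f q.1‖ ≤ K * |q.2| ∧
      ‖fderiv ℝ (fderiv ℝ f) x - fderiv ℝ (fderiv ℝ f) q.1‖ ≤ K * |q.2| ∧
      ‖fderiv ℝ (fderiv ℝ f) x - fderiv ℝ (fderiv ℝ f) q.1
        - q.2 • fderiv ℝ (fderiv ℝ (fderiv ℝ f)) q.1 (∇ f q.1)‖ ≤ K * q.2 ^ 2 ∧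
      |q.2| ≤ K * |f x - f q.1| := by
  have hgrad : ContDiffAt ℝ 1 (∇ f) p := contDiffAt_gradient hf (by norm_num)
  have hhess : ContDiffAt ℝ 2 (fderiv ℝ (fderiv ℝ f)) p :=
    (hf.fderiv_right (m := 3) (by norm_num)).fderiv_right (by norm_num)
  have htrans : fderiv ℝ f p (∇ f p) ≠ 0 := by
    rw [fderiv_apply_gradient]
    positivity
  have hhess_bdd :
      (fun q : E × ℝ => fderiv ℝ (fderiv ℝ f) q.1) =O[𝓝 (p, 0)] fun _ => (1 : ℝ) :=
    (hhess.continuousAt.comp_of_eq (f := Prod.fst) continuousAt_fst rfl).tendsto.isBigO_one ℝ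
  have hbounds := (eventually_gt_atTop 0).and <| (isBigO_iff_eventually.1 hhess_bdd).and <|
    (isBigO_iff_eventually.1 (isBigO_comp_add_smul_sub hgrad hgrad.continuousAt)).and <|
    (isBigO_iff_eventually.1
      (isBigO_comp_add_smul_sub (hhess.of_le one_le_two) hgrad.continuousAt)).and <|
    (isBigO_iff_eventually.1
      (isBigO_comp_add_smul_sub_sub_fderiv hhess hgrad.continuousAt)).and <|
    isBigO_iff_eventually.1 (isBigO_snd_comp_add_smul_sub
      (hf.hasStrictFDerivAt four_ne_zero) hgrad.continuousAt htrans)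
  obtain ⟨K, hK0, hA, hgradK, hhessK, htaylorK, htK⟩ := hbounds.exists
  have hsmall : ∀ᶠ q : E × ℝ in 𝓝 (p, 0), 2 * K * |q.2| ≤ 1 := by
    have hcont : ContinuousAt (fun q : E × ℝ => 2 * K * |q.2|) (p, 0) := by fun_prop
    exact hcont.eventually_le_const (by simp)
  refine ⟨K, hK0, ?_⟩
  filter_upwards [hA, hsmall, hgradK, hhessK, htaylorK, htK] with q hA hsmall hgrad hhess htaylor ht
  simp only [norm_one, mul_one, norm_pow, Real.norm_eq_abs, sq_abs] at hA hgrad hhess htaylor ht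
  exact ⟨hA, hsmall, hgrad, hhess, htaylor, ht⟩

theorem exists_neg_sq_le_fderiv_fderiv_apply_self (hf : ContDiffAt ℝ 4 f p)
    (hfp : f p = 0) (hnorm : ∀ᶠ y in 𝓝 p, f y = 0 → ‖∇ f y‖ = 1)
    (hpos : ∀ᶠ y in 𝓝 p, f y = 0 → ∀ τ, inner ℝ (∇ f y) τ = 0 →
      0 ≤ fderiv ℝ (fderiv ℝ f) y τ τ) :
    ∃ C₁ C₂ : ℝ, 0 < C₁ ∧ 0 < C₂ ∧ ∀ᶠ x in 𝓝 p, ∀ ξ,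
      -(C₁ * f x ^ 2 * ‖ξ‖ ^ 2) - C₂ * inner ℝ (∇ f x) ξ ^ 2 ≤ fderiv ℝ (fderiv ℝ f) x ξ ξ := by
  have hν : ‖∇ f p‖ = 1 := hnorm.self_of_nhds hfp
  have hν0 : ∇ f p ≠ 0 := norm_ne_zero_iff.1 (hν.trans_ne one_ne_zero)
  have hgrad : ContDiffAt ℝ 1 (∇ f) p := contDiffAt_gradient hf (by norm_num)
  obtain ⟨K, hK0, hbounds⟩ := exists_gradient_displacement_bounds hf hν0
  refine ⟨K ^ 3 * (1 + 5 * K + 2 * K ^ 2), 2 * (2 + K), by positivity, by positivity, ?_⟩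
  have hfill := nhds_le_map_add_smul_nhdsWithin (hf.hasStrictFDerivAt four_ne_zero)
    (hgrad.hasStrictFDerivAt one_ne_zero) hfp (by rw [fderiv_apply_gradient, hν]; norm_num)
  have hx : Tendsto (fun q : E × ℝ => q.1 + q.2 • ∇ f q.1) (𝓝 (p, 0)) (𝓝 p) :=
    continuousAt_fst.tendsto.comp (tendsto_add_smul_prodMk_nhds hgrad.continuousAt)
  have hy : Tendsto (Prod.fst : E × ℝ → E) (𝓝 (p, 0)) (𝓝 p) := continuousAt_fst
  refine Eventually.filter_mono hfill (eventually_map.2 (eventually_nhdsWithin_iff.2 ?_))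
  filter_upwards [hbounds, hx.eventually (hf.eventually (by simp)),
    hy.eventually (hf.eventually (by simp)), hy.eventually hnorm.eventually_nhds,
    hy.eventually hpos] with q ⟨hK, hKt, hgradK, hhessK, htaylorK, htK⟩ hfx hfy hnorm hpos hq ξ
  rw [hq, sub_zero] at htK
  have hlevel : ∀ᶠ z in 𝓝 q.1, f z = f q.1 → ‖∇ f z‖ = 1 := by rwa [hq]
  have ht : q.2 ^ 2 ≤ K ^ 2 * f (q.1 + q.2 • ∇ f q.1) ^ 2 := by
    simpa only [mul_pow, sq_abs] using pow_le_pow_left₀ (abs_nonneg _) htK 2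
  have hc := mul_le_mul_of_nonneg_left ht
    (by positivity : 0 ≤ K * (1 + 5 * K + 2 * K ^ 2) * ‖ξ‖ ^ 2)
  linarith [neg_le_fderiv_fderiv_apply_self (hfx.of_le (by norm_num)) (hfy.of_le (by norm_num))
    hlevel (hpos hq) hK hKt hgradK hhessK htaylorK ξ]

theorem exists_neg_sq_sub_div_le_fderiv_fderiv_apply_self (hf : ContDiffAt ℝ 4 f p)
    (hfp : f p = 0) (hnorm : ∀ᶠ y in 𝓝 p, f y = 0 → ‖∇ f y‖ = 1)
    (hpos : ∀ᶠ y in 𝓝 p, f y = 0 → ∀ τ, inner ℝ (∇ f y) τ = 0 →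
      0 ≤ fderiv ℝ (fderiv ℝ f) y τ τ) :
    ∃ C₁ C₂ : ℝ, 0 < C₁ ∧ 0 < C₂ ∧ ∀ᶠ x in 𝓝 p, ∇ f x ≠ 0 ∧ ∀ ξ,
      -C₁ * (f x) ^ 2 * ‖ξ‖ ^ 2 - C₂ * (|inner ℝ (∇ f x) ξ| ^ 2 / ‖∇ f x‖ ^ 2) ≤
        fderiv ℝ (fderiv ℝ f) x ξ ξ := by
  obtain ⟨C₁, C₂, hC₁, hC₂, hbound⟩ := exists_neg_sq_le_fderiv_fderiv_apply_self hf hfp hnorm hpos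
  have hgrad : ContinuousAt (∇ f) p :=
    (contDiffAt_gradient (m := 3) hf (by norm_num)).continuousAt
  have hν : ‖∇ f p‖ = 1 := hnorm.self_of_nhds hfp
  have hne : ∀ᶠ x in 𝓝 p, ∇ f x ≠ 0 :=
    hgrad.eventually_ne (norm_ne_zero_iff.1 (hν.trans_ne one_ne_zero))
  have hle : ∀ᶠ x in 𝓝 p, ‖∇ f x‖ ≤ 2 := hgrad.norm.eventually_le_const (by simp [hν])
  refine ⟨C₁, 4 * C₂, hC₁, by positivity, ?_⟩
  filter_upwards [hbound, hne, hle] with x hbound hne hle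
  refine ⟨hne, fun ξ => ?_⟩
  have hnormalize : inner ℝ (∇ f x) ξ ^ 2 ≤ 4 * (|inner ℝ (∇ f x) ξ| ^ 2 / ‖∇ f x‖ ^ 2) := by
    rw [sq_abs, ← mul_div_assoc, le_div_iff₀ (by positivity), mul_comm]
    gcongr
    linarith [pow_le_pow_left₀ (norm_nonneg _) hle 2]
  linarith [hbound ξ, mul_le_mul_of_nonneg_left hnormalize hC₂.le]

end NormalDisplacement

end InnerProductSpace

section LocalDefiningFunction

variable {E : Type*} [NormedAddCommGroup E] [NormedSpace ℝ E] {Ω : Set E} {ρ σ : E → ℝ} {v x : E}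

lemma exists_apply_neg_of_ne_zero {φ : E →L[ℝ] ℝ} (hφ : φ ≠ 0) : ∃ v, φ v < 0 := by
  obtain ⟨w, hw⟩ := DFunLike.ne_iff.1 hφ
  rcases lt_or_gt_of_ne hw with hneg | hpos
  · exact ⟨w, hneg⟩
  · exact ⟨-w, by simpa using hpos⟩

lemma tendsto_add_smul_nhdsGT_zero (x v : E) :
    Tendsto (fun s : ℝ => x + s • v) (𝓝[>] 0) (𝓝 x) := by
  have hcont : Continuous fun s : ℝ => x + s • v := by fun_prop
  simpa using (hcont.tendsto 0).mono_left nhdsWithin_le_nhds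

lemma eventually_neg_of_fderiv_neg (hσ : DifferentiableAt ℝ σ x) (hx : σ x = 0)
    (hv : fderiv ℝ σ x v < 0) : ∀ᶠ s in 𝓝[>] (0 : ℝ), σ (x + s • v) < 0 := by
  have hline : HasDerivAt (fun s : ℝ => x + s • v) v 0 := by
    simpa using ((hasDerivAt_id (0 : ℝ)).smul_const v).const_add x
  have hderiv : HasDerivAt (fun s : ℝ => σ (x + s • v)) (fderiv ℝ σ x v) 0 :=
    HasFDerivAt.comp_hasDerivAt (0 : ℝ) (by simpa using hσ.hasFDerivAt) hline
  have hsign := eventually_nhdsWithin_sign_eq_of_deriv_neg (by rwa [hderiv.deriv])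
    (by simpa using hx)
  filter_upwards [nhdsWithin_le_nhds hsign, self_mem_nhdsWithin] with s hs (hs0 : 0 < s)
  rwa [zero_sub, Left.sign_neg, sign_pos hs0, sign_eq_neg_one_iff] at hs

lemma fderiv_apply_nonpos_of_eventually_neg (hσ : DifferentiableAt ℝ σ x)
    (hρ : DifferentiableAt ℝ ρ x) (hσx : σ x = 0) (hρx : ρ x = 0)
    (h : ∀ᶠ z in 𝓝 x, σ z < 0 → ρ z < 0) (hv : fderiv ℝ σ x v < 0) : fderiv ℝ ρ x v ≤ 0 := by
  by_contra! hpos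
  have hσneg := eventually_neg_of_fderiv_neg hσ hσx hv
  have hρpos := eventually_neg_of_fderiv_neg (σ := fun z => -ρ z) hρ.neg (by simpa using hρx)
    (by simpa [fderiv_fun_neg] using hpos)
  have hray := (tendsto_add_smul_nhdsGT_zero x v).eventually h
  obtain ⟨s, hs, hs', hs''⟩ := (hσneg.and (hρpos.and hray)).exists
  exact (neg_neg_iff_pos.1 hs').not_gt (hs'' hs)

lemma eventually_mem_iff_neg {X : Type*} [TopologicalSpace X] {Ω U : Set X} {σ : X → ℝ} {x : X}
    (hU : IsOpen U) (hσΩ : Ω ∩ U = {z ∈ U | σ z < 0}) (hx : x ∈ U) :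
    ∀ᶠ z in 𝓝 x, (z ∈ Ω ↔ σ z < 0) := by
  filter_upwards [hU.mem_nhds hx] with z hz
  simpa [hz] using Set.ext_iff.1 hσΩ z

lemma eq_zero_of_mem_frontier {X : Type*} [TopologicalSpace X] {Ω : Set X} {σ : X → ℝ} {x : X}
    (hσ : ContinuousAt σ x) (h : ∀ᶠ z in 𝓝 x, (z ∈ Ω ↔ σ z < 0)) (hx : x ∈ frontier Ω) :
    σ x = 0 := by
  refine le_antisymm (not_lt.1 fun hpos => ?_) (not_lt.1 fun hneg => hx.2 ?_)
  · obtain ⟨z, hzΩ, hz, hσz⟩ := ((mem_closure_iff_frequently.1 hx.1).and_eventually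
      (h.and (hσ.eventually_const_lt hpos))).exists
    exact hσz.not_gt (hz.1 hzΩ)
  · refine mem_interior_iff_mem_nhds.2 ?_
    filter_upwards [h, hσ.eventually_lt_const hneg] with z hz hσz using hz.2 hσz

lemma mem_frontier_of_eq_zero (hσ : DifferentiableAt ℝ σ x)
    (h : ∀ᶠ z in 𝓝 x, (z ∈ Ω ↔ σ z < 0)) (hx : σ x = 0) (hdσ : fderiv ℝ σ x ≠ 0) :
    x ∈ frontier Ω := by
  refine ⟨?_, fun hint => (h.self_of_nhds.1 (interior_subset hint)).ne hx⟩
  obtain ⟨v, hv⟩ := exists_apply_neg_of_ne_zero hdσ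
  have hray := tendsto_add_smul_nhdsGT_zero x v
  refine mem_closure_of_tendsto hray ?_
  filter_upwards [hray.eventually h, eventually_neg_of_fderiv_neg hσ hx hv] with s hs hneg
    using hs.2 hneg

lemma fderiv_fderiv_nonneg_of_eventually_neg [CompleteSpace E] (hσ : ContDiffAt ℝ 2 σ x)
    (hρ : ContDiffAt ℝ 2 ρ x) (hσx : σ x = 0) (hdσ : fderiv ℝ σ x ≠ 0)
    (hdρ : fderiv ℝ ρ x ≠ 0) (hneg : ∀ᶠ z in 𝓝 x, σ z < 0 → ρ z < 0)
    (hzero : ∀ᶠ z in 𝓝 x, σ z = 0 → ρ z = 0)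
    (hconv : ∀ τ, fderiv ℝ ρ x τ = 0 → 0 ≤ fderiv ℝ (fderiv ℝ ρ) x τ τ) {τ : E}
    (hτ : fderiv ℝ σ x τ = 0) : 0 ≤ fderiv ℝ (fderiv ℝ σ) x τ τ := by
  have hρx : ρ x = 0 := hzero.self_of_nhds hσx
  have hlevel : ∀ᶠ z in 𝓝 x, σ z = σ x → ρ z = ρ x := by rwa [hσx, hρx]
  have hcomm := fderiv_mul_fderiv_comm_of_const_on_level (hρ.hasStrictFDerivAt two_ne_zero)
    (hσ.hasStrictFDerivAt two_ne_zero) hlevel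
  obtain ⟨v, hv⟩ := exists_apply_neg_of_ne_zero hdσ
  have hρv : fderiv ℝ ρ x v < 0 := by
    refine (fderiv_apply_nonpos_of_eventually_neg (hσ.differentiableAt two_ne_zero)
      (hρ.differentiableAt two_ne_zero) hσx hρx hneg hv).lt_of_ne fun hρv => hdρ ?_
    ext w
    simpa [hρv, hv.ne] using hcomm w v
  have hρτ : fderiv ℝ ρ x τ = 0 := by simpa [hτ, hv.ne] using hcomm τ v
  have hhess := fderiv_fderiv_mul_eq_of_const_on_level hρ hσ hlevel hτ hv.ne
  by_contra! hστ
  exact (mul_pos_of_neg_of_neg hρv hστ).not_ge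
    (hhess ▸ mul_nonpos_of_nonneg_of_nonpos (hconv τ hρτ) hv.le)

lemma fderiv_fderiv_nonneg_of_mem_frontier [CompleteSpace E] (hσ : ContDiffAt ℝ 2 σ x)
    (hρ : ContDiffAt ℝ 2 ρ x) (hσΩ : ∀ᶠ z in 𝓝 x, (z ∈ Ω ↔ σ z < 0))
    (hρΩ : ∀ᶠ z in 𝓝 x, (z ∈ Ω ↔ ρ z < 0)) (hx : x ∈ frontier Ω) (hdσ : fderiv ℝ σ x ≠ 0)
    (hdρ : fderiv ℝ ρ x ≠ 0)
    (hconv : ∀ τ, fderiv ℝ ρ x τ = 0 → 0 ≤ fderiv ℝ (fderiv ℝ ρ) x τ τ) {τ : E}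
    (hτ : fderiv ℝ σ x τ = 0) : 0 ≤ fderiv ℝ (fderiv ℝ σ) x τ τ := by
  have hneg : ∀ᶠ z in 𝓝 x, σ z < 0 → ρ z < 0 := by
    filter_upwards [hσΩ, hρΩ] with z hσz hρz hz using hρz.1 (hσz.2 hz)
  have hzero : ∀ᶠ z in 𝓝 x, σ z = 0 → ρ z = 0 := by
    have hdσ_cont : ContinuousAt (fderiv ℝ σ) x :=
      (hσ.fderiv_right (m := 1) (by norm_num)).continuousAt
    filter_upwards [hσ.eventually (by simp), hρ.eventually (by simp), hσΩ.eventually_nhds,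
      hρΩ.eventually_nhds, hdσ_cont.eventually_ne hdσ] with z hσz hρz hσΩz hρΩz hdσz hz
    exact eq_zero_of_mem_frontier hρz.continuousAt hρΩz
      (mem_frontier_of_eq_zero (hσz.differentiableAt two_ne_zero) hσΩz hz hdσz)
  exact fderiv_fderiv_nonneg_of_eventually_neg hσ hρ
    (eq_zero_of_mem_frontier hσ.continuousAt hσΩ hx) hdσ hdρ hneg hzero hconv hτ

end LocalDefiningFunction

theorem propositionP_general {E : Type*} [NormedAddCommGroup E] [InnerProductSpace ℝ E]
    [CompleteSpace E] {Ω U : Set E} {p : E} (hp : p ∈ frontier Ω) (hU : IsOpen U) (hpU : p ∈ U)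
    {σ : E → ℝ} (hσ : ContDiffOn ℝ 4 σ U) (hσΩ : Ω ∩ U = {x ∈ U | σ x < 0})
    (hσ1 : ∀ x ∈ frontier Ω ∩ U, ‖∇ σ x‖ = 1) {ρ : E → ℝ} (hρ : ContDiffOn ℝ 2 ρ U)
    (hρΩ : Ω ∩ U = {x ∈ U | ρ x < 0}) (hρ0 : ∀ x ∈ frontier Ω ∩ U, ∇ ρ x ≠ 0)
    (hconv : ∀ x ∈ frontier Ω ∩ U, ∀ ξ, inner ℝ (∇ ρ x) ξ = 0 →
      0 ≤ fderiv ℝ (fderiv ℝ ρ) x ξ ξ) :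
    ∃ V : Set E, IsOpen V ∧ p ∈ V ∧ V ⊆ U ∧ ∃ C₁ C₂ : ℝ, 0 < C₁ ∧ 0 < C₂ ∧
      ∀ x ∈ V, ∇ σ x ≠ 0 ∧ ∀ ξ : E,
        -C₁ * (σ x) ^ 2 * ‖ξ‖ ^ 2 - C₂ * (|inner ℝ (∇ σ x) ξ| ^ 2 / ‖∇ σ x‖ ^ 2)
          ≤ fderiv ℝ (fderiv ℝ σ) x ξ ξ := by
  have hσU {x : E} (hx : x ∈ U) : ContDiffAt ℝ 4 σ x := hσ.contDiffAt (hU.mem_nhds hx)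
  have hσ_neg {x : E} (hx : x ∈ U) : ∀ᶠ z in 𝓝 x, (z ∈ Ω ↔ σ z < 0) :=
    eventually_mem_iff_neg hU hσΩ hx
  have hσp : σ p = 0 := eq_zero_of_mem_frontier (hσU hpU).continuousAt (hσ_neg hpU) hp
  have hgrad : ContinuousAt (∇ σ) p :=
    (contDiffAt_gradient (m := 3) (hσU hpU) (by norm_num)).continuousAt
  have hnear : ∀ᶠ x in 𝓝 p, x ∈ U ∧ ∇ σ x ≠ 0 :=
    (hU.eventually_mem hpU).and (hgrad.eventually_ne
      (norm_ne_zero_iff.1 ((hσ1 p ⟨hp, hpU⟩).trans_ne one_ne_zero)))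
  have hfrontier {x : E} (hxU : x ∈ U) (hdσ : ∇ σ x ≠ 0) (hx : σ x = 0) : x ∈ frontier Ω :=
    mem_frontier_of_eq_zero ((hσU hxU).differentiableAt four_ne_zero) (hσ_neg hxU) hx
      (gradient_ne_zero_iff.1 hdσ)
  have hpos : ∀ᶠ x in 𝓝 p, σ x = 0 → ∀ τ, inner ℝ (∇ σ x) τ = 0 →
      0 ≤ fderiv ℝ (fderiv ℝ σ) x τ τ := by
    filter_upwards [hnear] with x ⟨hxU, hdσ⟩ hx τ hτ
    have hxΩ := hfrontier hxU hdσ hx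
    refine fderiv_fderiv_nonneg_of_mem_frontier ((hσU hxU).of_le (by norm_num))
      (hρ.contDiffAt (hU.mem_nhds hxU)) (hσ_neg hxU)
      (eventually_mem_iff_neg hU hρΩ hxU) hxΩ (gradient_ne_zero_iff.1 hdσ)
      (gradient_ne_zero_iff.1 (hρ0 x ⟨hxΩ, hxU⟩)) ?_ (by rwa [← inner_gradient_left])
    simpa only [inner_gradient_left] using hconv x ⟨hxΩ, hxU⟩
  obtain ⟨C₁, C₂, hC₁, hC₂, hbound⟩ := exists_neg_sq_sub_div_le_fderiv_fderiv_apply_self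
    (hσU hpU) hσp (hnear.mono fun x hx hσx => hσ1 x ⟨hfrontier hx.1 hx.2 hσx, hx.1⟩) hpos
  obtain ⟨V, hV, hVo, hpV⟩ := eventually_nhds_iff.1 ((hU.eventually_mem hpU).and hbound)
  exact ⟨V, hVo, hpV, fun x hx => (hV x hx).1, C₁, C₂, hC₁, hC₂, fun x hx => (hV x hx).2⟩

theorem propositionP (n : ℕ) (Ω : Set (EuclideanSpace ℝ (Fin n))) (hΩ : IsSmoothlyBounded Ω)
    (p : EuclideanSpace ℝ (Fin n)) (hp : p ∈ frontier Ω)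
    (U : Set (EuclideanSpace ℝ (Fin n))) (hU : IsOpen U) (hpU : p ∈ U)
    (σ : EuclideanSpace ℝ (Fin n) → ℝ) (hσ : IsSmoothLocalDefiningFunction Ω U σ)
    (hσ1 : ∀ x ∈ frontier Ω ∩ U, ‖gradient σ x‖ = 1)
    (hconv : IsConvexDomainOn Ω U) :
    ∃ V : Set (EuclideanSpace ℝ (Fin n)), IsOpen V ∧ p ∈ V ∧ V ⊆ U ∧
      ∃ C₁ C₂ : ℝ, 0 < C₁ ∧ 0 < C₂ ∧
        ∀ x ∈ V, gradient σ x ≠ 0 ∧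
          ∀ ξ : EuclideanSpace ℝ (Fin n),
            -C₁ * (σ x) ^ 2 * ‖ξ‖ ^ 2
                - C₂ * (|inner ℝ (gradient σ x) ξ| ^ 2 / ‖gradient σ x‖ ^ 2)
              ≤ realHessian σ ξ ξ x := by
  obtain ⟨ρ, ⟨hρ, hρΩ⟩, hρ0, hconv⟩ := hconv
  exact propositionP_general hp hU hpU (hσ.1.of_le (mod_cast ENat.LEInfty.out)) hσ.2 hσ1
    (hρ.of_le (mod_cast ENat.LEInfty.out)) hρΩ hρ0 hconv
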